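/- Setting. Let $N$ be a finite rooted tree whose root is the source and whose leaves (other than the root) are the sinks; fix $n\ge 1$ and $H>0$. Every edge $e$ has a resistance $k_e\ge 0$, and the head loss in $e$ at flow rate $Q$ is $k_eQ^n$. The source has head $H$, all sinks have head $0$, and material leaves the network only at the sinks. Each terminal edge (edge leading to a sink) carries a valve. A discrete valve is fully open (the edge has resistance $k_e$) or closed (no flow); a continuous valve may also give its edge any resistance $r_e\ge k_e$. In each state the flow rates are an equilibrium (if zero resistances leave the split between sinks undetermined, every split is allowed). A sink joined to the source by an open route of zero resistance is supplied instantaneously, in zero time. A schedule is a finite sequence of states with durations; it meets the demand $D=(D_i)\ge 0$ if it delivers exactly $D_i$ to each sink $i$. An instance $(k,D)$ on $N$ consists of such $k$ and $D$ with $D_i>0$ for at least one sink $i$ whose route from the source has positive resistance. Let $t_d(k,D)$ and $t_{cv}(k,D)$ be the minimal (infimal) times of schedules that meet $D$ with discrete and with continuous valves, and $\mathbf R(k,D)=t_d(k,D)/t_{cv}(k,D)$. Let $\mathbb D'(k)$ be the set of demands that can be met with continuous valves in one unit of time in a single state. Schedule $\mathcal S$ (discrete valves): open the valves of all sinks with positive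 demand; whenever the demand of a sink is met, close its valve; stop when all demands are met. Class $\mathcal C$: those $k$ for which there is a sink $v$ (whose route from the source is the "main path") such that $k_e>0$ for every edge on the main path and $k_e=0$ for every other edge. Theorem. For every such $N$, $n$, $H$, with all suprema taken over instances on $N$: 1. The supremum of $\mathbf R$ is given by the class $\mathcal C$: $\sup_{(k,D)}\mathbf R(k,D)=\sup_{(k,D),\,k\in\mathcal C}\mathbf R(k,D)$. Moreover this number equals the supremum, over instances with $k\in\mathcal C$ and $D\in\mathbb D'(k)$, of the time taken by schedule $\mathcal S$. 2. Schedule $\mathcal S$ takes the longest time in the class $\mathcal C$: the supremum of the time of $\mathcal S$ over all instances with $D\in\mathbb D'(k)$ equals its supremum over those with in addition $k\in\mathcal C$. 3. Schedule $\mathcal S$ can be executed on every instance, and if $k\in\mathcal C$ it is optimal for discrete valves: it meets the demand, and no schedule with discrete valves that meets the demand takes less time. 4. Instance by instance: if an execution of $\mathcal S$ on an instance $(k,D)$ takes time $T$ and the valve of $v$ is (one of) the last to be closed, let $k'$ agree with $k$ on the route from the source to $v$ and be $0$ on all other edges (so $k'\in\mathcal C$ if $k$ is positive on that route). Then $(k',D)$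 is an instance, every execution of $\mathcal S$ on it takes time at least $T$, $t_{cv}(k',D)\le t_{cv}(k,D)$, and $\mathbf R(k,D)\le\mathbf R(k',D)$. -/

import Mathlib

open scoped ENNReal

namespace SupplyNetwork

/-! A branched network is a finite rooted tree `N` in the sense of Mathlib's `RootedTree`: the source
is the root `⊥`, the parent of `v` is `Order.pred v`, and `u ≤ v` says that `u` lies on the route
from the source to `v`. -/

/-- The edges of the network: a vertex `v ≠ ⊥` stands for the edge from `Order.pred v` to `v`. -/
abbrev Edge (N : RootedTree) : Type _ := {v : N // v ≠ ⊥}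

/-- The sinks (demand nodes) are the leaves; a sink also names the terminal edge that leads to it,
which carries its valve. -/
abbrev Sink (N : RootedTree) : Type _ := {e : Edge N // IsMax e.1}

open Classical in
/-- The flow through the edge `e` when the sinks receive `q`: since material leaves the network only
at the sinks, it is the total received by the sinks downstream of `e`. -/
noncomputable def edgeFlow {N : RootedTree} [Fintype N] (q : Sink N → ℝ) (e : Edge N) : ℝ :=
  ∑ i : Sink N, if e ≤ i.1 then q i else 0

/-- `q` is an equilibrium distribution of flow rates when the edges have resistances `r` and exactly
the valves in `O` are not closed: the source is at head `H`, all sinks are at head `0`, and the head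
loss in every edge other than a closed terminal edge is `r Q ^ n`. -/
def IsEquilibrium {N : RootedTree} [Fintype N] (n H : ℝ) (r : Edge N → ℝ) (O : Set (Sink N))
    (q : Sink N → ℝ) : Prop :=
  (∀ i, 0 ≤ q i) ∧ (∀ i, i ∉ O → q i = 0) ∧
    ∃ h : N → ℝ, h ⊥ = H ∧ (∀ i : Sink N, h i.1.1 = 0) ∧
      ∀ e : Edge N, (∀ he : IsMax e.1, (⟨e, he⟩ : Sink N) ∈ O) →
        h (Order.pred e.1) - h e.1 = r e * edgeFlow q e ^ n

/-- The network, in the state with resistances `r` and set `O` of valves that are not closed, can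
deliver the amounts `V` to the sinks in time `τ`. For `τ > 0` this is supply at equilibrium flow
rates. A sink joined to the source by a route of zero resistance would draw an infinite flow rate,
and there is no equilibrium while its valve is fully open; the convention `τ = 0` says that it is
then supplied instantaneously, and that nothing passes through an edge of positive resistance in
zero time. -/
def Delivers {N : RootedTree} [Fintype N] (n H : ℝ) (r : Edge N → ℝ) (O : Set (Sink N))
    (τ : ℝ) (V : Sink N → ℝ) : Prop :=
  (0 < τ ∧ ∃ q, IsEquilibrium n H r O q ∧ V = τ • q) ∨
  (τ = 0 ∧ (∀ i, 0 ≤ V i) ∧ (∀ i, i ∉ O → V i = 0) ∧ ∀ e, r e * edgeFlow V e = 0)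

/-- The resistances `r` that continuous valves can produce in a network whose edges have resistances
`k` when fully open: a valve can only add resistance, and only to its own terminal edge. -/
def IsSetting {N : RootedTree} (k r : Edge N → ℝ) : Prop :=
  ∀ e, k e ≤ r e ∧ (¬ IsMax e.1 → r e = k e)

/-- One phase of a schedule: the state of the network, its active time, the amounts delivered. -/
structure Phase (N : RootedTree) where
  resistance : Edge N → ℝ
  opened : Set (Sink N)
  duration : ℝ
  volume : Sink N → ℝ

/-- A phase that discrete (fully open or fully closed) valves can realize. -/
def IsDiscretePhase {N : RootedTree} [Fintype N] (n H : ℝ) (k : Edge N → ℝ) (p : Phase N) : Prop :=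
  p.resistance = k ∧ Delivers n H p.resistance p.opened p.duration p.volume

/-- A phase that continuous valves can realize. -/
def IsContinuousPhase {N : RootedTree} [Fintype N] (n H : ℝ) (k : Edge N → ℝ) (p : Phase N) :
    Prop :=
  IsSetting k p.resistance ∧ Delivers n H p.resistance p.opened p.duration p.volume

/-- The operational times of the schedules with discrete valves that meet the demand `D`. -/
def discreteTimes {N : RootedTree} [Fintype N] (n H : ℝ) (k : Edge N → ℝ) (D : Sink N → ℝ) :
    Set ℝ :=
  {T | ∃ L : List (Phase N), (∀ p ∈ L, IsDiscretePhase n H k p) ∧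
    (L.map Phase.volume).sum = D ∧ (L.map Phase.duration).sum = T}

/-- The operational times of the schedules with continuous valves that meet the demand `D`. -/
def continuousTimes {N : RootedTree} [Fintype N] (n H : ℝ) (k : Edge N → ℝ) (D : Sink N → ℝ) :
    Set ℝ :=
  {T | ∃ L : List (Phase N), (∀ p ∈ L, IsContinuousPhase n H k p) ∧
    (L.map Phase.volume).sum = D ∧ (L.map Phase.duration).sum = T}

/-- The minimal operational time with discrete valves. -/
noncomputable def minDiscreteTime {N : RootedTree} [Fintype N] (n H : ℝ) (k : Edge N → ℝ)
    (D : Sink N → ℝ) : ℝ≥0∞ :=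
  ⨅ T ∈ discreteTimes n H k D, ENNReal.ofReal T

/-- The minimal operational time with continuous valves. -/
noncomputable def minContinuousTime {N : RootedTree} [Fintype N] (n H : ℝ) (k : Edge N → ℝ)
    (D : Sink N → ℝ) : ℝ≥0∞ :=
  ⨅ T ∈ continuousTimes n H k D, ENNReal.ofReal T

/-- The ratio `R` of the minimal operational times with discrete and with continuous valves. -/
noncomputable def ratio {N : RootedTree} [Fintype N] (n H : ℝ) (k : Edge N → ℝ)
    (D : Sink N → ℝ) : ℝ≥0∞ :=
  minDiscreteTime n H k D / minContinuousTime n H k D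

/-- Resistances and demands of a supply problem: they are non-negative, and some positive demand
lies behind an edge of positive resistance (otherwise no time is needed at all). -/
def IsInstance {N : RootedTree} (k : Edge N → ℝ) (D : Sink N → ℝ) : Prop :=
  (∀ e, 0 ≤ k e) ∧ (∀ i, 0 ≤ D i) ∧ ∃ i, 0 < D i ∧ ∃ e : Edge N, e ≤ i.1 ∧ 0 < k e

/-- Demands that continuous valves meet in one unit of time in a single configuration. -/
def IsUnitDemand {N : RootedTree} [Fintype N] (n H : ℝ) (k : Edge N → ℝ) (D : Sink N → ℝ) : Prop :=
  ∃ r O, IsSetting k r ∧ Delivers n H r O 1 D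

/-- `ScheduleS n H k d T v`: with discrete valves and remaining demands `d`, an execution of the
schedule "keep exactly the valves of the unsatisfied sinks open, and close a valve as soon as the
demand of its sink is met" takes the time `T`, and the valve of `v` is among the last to be closed. -/
inductive ScheduleS {N : RootedTree} [Fintype N] (n H : ℝ) (k : Edge N → ℝ) :
    (Sink N → ℝ) → ℝ → Sink N → Prop
  | last {d : Sink N → ℝ} {τ : ℝ} {v : Sink N} :
      Delivers n H k {i | 0 < d i} τ d → 0 < d v → ScheduleS n H k d τ v
  | step {d V : Sink N → ℝ} {τ T : ℝ} {v : Sink N} :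
      Delivers n H k {i | 0 < d i} τ V → (∀ i, V i ≤ d i) → (∃ i, 0 < d i ∧ V i = d i) →
      ScheduleS n H k (d - V) T v → ScheduleS n H k d (τ + T) v

/-- The class of networks in which exactly the edges of one route from the source to a sink (the
main path) have positive resistance, all others having resistance zero. -/
def InClassC {N : RootedTree} (k : Edge N → ℝ) : Prop :=
  ∃ v : Sink N, (∀ e : Edge N, e ≤ v.1 → 0 < k e) ∧ ∀ e : Edge N, ¬ e ≤ v.1 → k e = 0

open Classical in
/-- The modified network: the route from the source to `v` keeps its resistances, and all other
edges get resistance zero. -/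
noncomputable def mainPathNetwork {N : RootedTree} (k : Edge N → ℝ) (v : Sink N) : Edge N → ℝ :=
  fun e => if e ≤ v.1 then k e else 0

end SupplyNetwork

open SupplyNetwork

/-!
For a sink `v`, the quantity `∑ k Q ^ n / H`, taken over the edges of the route from the source to
`v`, is the fraction of the head that flow rates `q` lose along that route. Its `n`-th root,
`pathNorm`, is homogeneous and subadditive in `q ≥ 0` by Minkowski's inequality, since the flows `Q`
through the edges are linear in `q`; `pathCost` is the sum of the norms of the separate demands
`q i • δ i`.

* No setting of the valves loses more than `H` along a route, so every phase has a path norm of at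
  most its duration, and the path norm of the demand bounds the continuous time from below
  (`pathNorm_le_of_mem_continuousTimes`). If all resistances lie on the route to `v`, every demand of
  path norm one can be delivered in one unit of time by throttling, so that this bound is attained
  (`pathNorm_mem_continuousTimes`).
* While a discrete valve is open exactly `H` is lost along its route. So if `v` is the last sink to
  be served in schedule `S`, each phase of positive duration has flow rates of path norm one, hence
  of path cost at least one, and the time of `S` is at most the path cost of the demand
  (`ScheduleS.le_pathCost`).
* If all resistances lie on the route to `v`, then in a discrete state the whole flow leaves that
  route where the first open sink branches off: the head is `0` there, as only edges of resistance
  zero lead on to that sink, so that nothing flows through edges of positive resistance further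
  down. So the flow rates of a discrete phase have path cost at most one
  (`IsEquilibrium.pathCost_le_one`), and the path cost of the demand bounds the discrete time from
  below (`pathCost_le_of_mem_discreteTimes`).

As path norm and path cost see only the resistances on the route to `v`, these bounds show that
dropping all other resistances decreases neither the time of `S` nor the ratio, and that both suprema are
suprema of quotients of path cost and path norm. The main path may contain edges of resistance
zero; such quotients are limits of those of the class `C`, by increasing the resistances on the path
by a small constant (`pathCost_div_pathNorm_le_iSup`).

That `S` can be executed rests on the existence of equilibria (`exists_isEquilibrium`): a
distribution of a unit of flow that minimises `∑ k Q ^ (n + 1)` loses the same head on the routes to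
all open sinks, and can be scaled to make this loss equal to `H` if each of these routes has a
positive resistance. Sinks on routes of resistance zero are served in zero time beforehand.
-/

namespace SupplyNetwork

/-! ### Edges and sinks of a rooted tree -/

variable {N : RootedTree}

lemma Sink.eq_of_le {i j : Sink N} (h : i.1 ≤ j.1) : i = j :=
  Subtype.ext (Subtype.ext (le_antisymm h (i.2 h)))

lemma Sink.single_nonneg [DecidableEq (Sink N)] (i j : Sink N) :
    (0 : ℝ) ≤ (Pi.single i 1 : Sink N → ℝ) j := by
  rw [Pi.single_apply]
  split_ifs <;> simp

lemma Edge.le_total_of_le {e f g : Edge N} (he : e ≤ g) (hf : f ≤ g) : e ≤ f ∨ f ≤ e :=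
  le_total_of_directed (v₁ := f.1) (v₂ := e.1) (r := g.1) hf he

lemma Edge.pred_lt (e : Edge N) : Order.pred e.1 < e.1 :=
  Order.pred_lt_of_not_isMin fun h => e.2 h.eq_bot

lemma mainPathNetwork_nonneg {k : Edge N → ℝ} {v : Sink N} (hk : ∀ e, 0 ≤ k e) (e : Edge N) :
    0 ≤ mainPathNetwork k v e := by
  unfold mainPathNetwork
  split_ifs
  exacts [hk e, le_rfl]

lemma mainPathNetwork_of_le {k : Edge N → ℝ} {v : Sink N} {e : Edge N} (h : e ≤ v.1) :
    mainPathNetwork k v e = k e :=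
  if_pos h

lemma mainPathNetwork_of_not_le {k : Edge N → ℝ} {v : Sink N} (e : Edge N) (h : ¬ e ≤ v.1) :
    mainPathNetwork k v e = 0 :=
  if_neg h

lemma inClassC_mainPathNetwork {k : Edge N → ℝ} {v : Sink N} (h : ∀ e ≤ v.1, 0 < k e) :
    InClassC (mainPathNetwork k v) :=
  ⟨v, fun e he => by rw [mainPathNetwork_of_le he]; exact h e he, mainPathNetwork_of_not_le⟩

variable [Fintype N]

/-! ### Flows through edges -/

lemma edgeFlow_nonneg {q : Sink N → ℝ} (hq : ∀ i, 0 ≤ q i) (e : Edge N) : 0 ≤ edgeFlow q e :=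
  Finset.sum_nonneg fun i _ => by split_ifs <;> simp [hq i]

lemma edgeFlow_add (q q' : Sink N → ℝ) (e : Edge N) :
    edgeFlow (q + q') e = edgeFlow q e + edgeFlow q' e := by
  simp only [edgeFlow, ← Finset.sum_add_distrib, Pi.add_apply]
  exact Finset.sum_congr rfl fun i _ => by split_ifs <;> simp

lemma edgeFlow_smul (c : ℝ) (q : Sink N → ℝ) (e : Edge N) :
    edgeFlow (c • q) e = c * edgeFlow q e := by
  simp [edgeFlow, Finset.mul_sum]

open Classical in
lemma edgeFlow_single (i : Sink N) (e : Edge N) :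
    edgeFlow (Pi.single i 1) e = if e ≤ i.1 then 1 else 0 := by
  rw [edgeFlow, Finset.sum_eq_single i] <;> simp +contextual

lemma le_edgeFlow {q : Sink N → ℝ} (hq : ∀ i, 0 ≤ q i) {e : Edge N} {i : Sink N} (h : e ≤ i.1) :
    q i ≤ edgeFlow q e := by
  classical
  have := Finset.single_le_sum (f := fun i : Sink N => if e ≤ i.1 then q i else 0)
    (fun j _ => by split_ifs <;> simp [hq j]) (Finset.mem_univ i)
  simpa [h, edgeFlow] using this

lemma exists_pos_of_edgeFlow_pos {q : Sink N → ℝ} {e : Edge N} (h : 0 < edgeFlow q e) :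
    ∃ i : Sink N, e ≤ i.1 ∧ 0 < q i := by
  by_contra! hc
  exact h.not_ge (Finset.sum_nonpos fun i _ => by split_ifs with hi <;> simp [hc, hi])

lemma edgeFlow_sink (q : Sink N → ℝ) (i : Sink N) : edgeFlow q i.1 = q i := by
  rw [edgeFlow, Finset.sum_eq_single i]
  · simp
  · exact fun j _ hj => if_neg fun h => hj (Sink.eq_of_le h).symm
  · simp

/-! ### Head loss along a route -/

open Classical in
lemma sum_edge_le_eq_pred_add (g : Edge N → ℝ) (e : Edge N) :
    ∑ f with f.1 ≤ e.1, g f = ∑ f : Edge N with f.1 ≤ Order.pred e.1, g f + g e := by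
  rw [add_comm, ← Finset.sum_insert]
  · congr 1
    ext f
    simp only [Finset.mem_filter, Finset.mem_univ, true_and, Finset.mem_insert]
    constructor
    · intro h
      rcases h.eq_or_lt with h | h
      · exact Or.inl (Subtype.ext h)
      · exact Or.inr (Order.le_pred_of_lt h)
    · rintro (rfl | h)
      · exact le_rfl
      · exact h.trans (Edge.pred_lt e).le
  · simp [(Edge.pred_lt e).not_ge]

open Classical in
/-- The head lost between the source and `u` is the sum of the losses in the edges in between. -/
lemma head_bot_sub {h : N → ℝ} {g : Edge N → ℝ} (u : N)
    (hg : ∀ e : Edge N, e.1 ≤ u → h (Order.pred e.1) - h e.1 = g e) :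
    h ⊥ - h u = ∑ e : Edge N with e.1 ≤ u, g e := by
  induction u using (Finite.to_wellFoundedLT (α := N)).induction with
  | ind u ih =>
    by_cases hu : u = ⊥
    · subst hu
      rw [Finset.filter_false_of_mem]
      · simp
      · exact fun e _ he => e.2 (le_bot_iff.1 he)
    · have h1 := Edge.pred_lt ⟨u, hu⟩
      have h2 := ih _ h1 fun e he => hg e (he.trans h1.le)
      have h3 := hg ⟨u, hu⟩ le_rfl
      have h4 := sum_edge_le_eq_pred_add g ⟨u, hu⟩
      simp only at h2 h3 h4
      linarith

open Classical in
/-- All edges on the route to an open sink obey the loss law, and the head drops from `H` to `0`. -/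
lemma IsEquilibrium.sum_loss {n H : ℝ} {r : Edge N → ℝ} {O : Set (Sink N)} {q : Sink N → ℝ}
    (hq : IsEquilibrium n H r O q) {i : Sink N} (hi : i ∈ O) :
    ∑ e with e ≤ i.1, r e * edgeFlow q e ^ n = H := by
  obtain ⟨-, -, h, hbot, hsink, hloss⟩ := hq
  have := head_bot_sub (h := h) (g := fun e => r e * edgeFlow q e ^ n) i.1.1 fun e he =>
    hloss e fun hmax => by
      have : (⟨e, hmax⟩ : Sink N) = i := Sink.eq_of_le he
      rwa [this]
  rw [hbot, hsink, sub_zero] at this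
  exact this.symm

open Classical in
/-- If no route to a sink that is supplied loses more than `c`, then no route at all does: beyond
the last edge with a positive flow nothing is lost, and that edge lies on the route to a sink that
is supplied. -/
lemma sum_loss_le_of_supplied {n c : ℝ} (hn : 1 ≤ n) (hc : 0 ≤ c) {r : Edge N → ℝ}
    {q : Sink N → ℝ} (hr : ∀ e, 0 ≤ r e) (hq : ∀ i, 0 ≤ q i)
    (h : ∀ i, 0 < q i → ∑ e with e ≤ i.1, r e * edgeFlow q e ^ n ≤ c) (v : Sink N) :
    ∑ e with e ≤ v.1, r e * edgeFlow q e ^ n ≤ c := by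
  have h0 : ∀ e, 0 ≤ edgeFlow q e := edgeFlow_nonneg hq
  have hterm : ∀ e, 0 ≤ r e * edgeFlow q e ^ n := fun e =>
    mul_nonneg (hr e) (Real.rpow_nonneg (h0 e) n)
  by_cases hex : ∃ e, e ≤ v.1 ∧ 0 < edgeFlow q e
  · obtain ⟨e, ⟨hev, he0⟩, hemax⟩ :=
      (Set.toFinite {e : Edge N | e ≤ v.1 ∧ 0 < edgeFlow q e}).exists_maximal hex
    obtain ⟨i, hei, hi⟩ := exists_pos_of_edgeFlow_pos he0
    refine le_trans ?_ (h i hi)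
    calc ∑ e with e ≤ v.1, r e * edgeFlow q e ^ n
        = ∑ e with e ≤ v.1 ∧ e ≤ i.1, r e * edgeFlow q e ^ n := by
          rw [← Finset.filter_filter]
          symm
          refine Finset.sum_filter_of_ne fun f hf hne => ?_
          have hfv : f ≤ v.1 := (Finset.mem_filter.1 hf).2
          have hf0 : 0 < edgeFlow q f := by
            refine (h0 f).lt_of_ne' fun hc => hne ?_
            rw [hc, Real.zero_rpow (by linarith), mul_zero]
          rcases Edge.le_total_of_le hfv hev with h | h
          · exact h.trans hei
          · exact (hemax ⟨hfv, hf0⟩ h).trans hei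
      _ ≤ _ := Finset.sum_le_sum_of_subset_of_nonneg
          (Finset.monotone_filter_right _ fun e _ h => h.2) fun e _ _ => hterm e
  · push Not at hex
    refine (Finset.sum_nonpos fun e he => ?_).trans hc
    rw [le_antisymm (hex e (Finset.mem_filter.1 he).2) (h0 e), Real.zero_rpow (by linarith),
      mul_zero]

open Classical in
lemma IsEquilibrium.sum_loss_le {n H : ℝ} (hn : 1 ≤ n) (hH : 0 ≤ H) {r : Edge N → ℝ}
    {O : Set (Sink N)} {q : Sink N → ℝ} (hr : ∀ e, 0 ≤ r e) (hq : IsEquilibrium n H r O q)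
    (v : Sink N) : ∑ e with e ≤ v.1, r e * edgeFlow q e ^ n ≤ H := by
  refine sum_loss_le_of_supplied hn hH hr hq.1 (fun i hi => (hq.sum_loss ?_).le) v
  by_contra hc
  exact hi.ne' (hq.2.1 i hc)

/-! ### The norm and the cost attached to a route -/

open Classical in
/-- The `ℓⁿ`-norm of the flows in the edges of the route from the source to `v`, weighted by the
resistances, in units of the head `H`: its `n`-th power is the fraction of `H` that is lost along
the route when the sinks receive `q`. -/
noncomputable def pathNorm (n H : ℝ) (k : Edge N → ℝ) (v : Sink N) (q : Sink N → ℝ) : ℝ :=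
  ((∑ e with e ≤ v.1, k e * edgeFlow q e ^ n) / H) ^ n⁻¹

open Classical in
/-- The sum of the path norms of the separate demands of all sinks: the time needed to supply the
sinks one by one through the route to `v` when all edges off that route have resistance zero. -/
noncomputable def pathCost (n H : ℝ) (k : Edge N → ℝ) (v : Sink N) (q : Sink N → ℝ) : ℝ :=
  ∑ i, q i * pathNorm n H k v (Pi.single i 1)

section

variable {n H : ℝ} {k : Edge N → ℝ} {v : Sink N} {q q' : Sink N → ℝ}

open Classical in
lemma pathLoss_nonneg (hk : ∀ e, 0 ≤ k e) (hq : ∀ i, 0 ≤ q i) :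
    0 ≤ ∑ e with e ≤ v.1, k e * edgeFlow q e ^ n :=
  Finset.sum_nonneg fun e _ => mul_nonneg (hk e) (Real.rpow_nonneg (edgeFlow_nonneg hq e) n)

lemma pathNorm_nonneg (hH : 0 < H) (hk : ∀ e, 0 ≤ k e) (hq : ∀ i, 0 ≤ q i) :
    0 ≤ pathNorm n H k v q :=
  Real.rpow_nonneg (div_nonneg (pathLoss_nonneg hk hq) hH.le) _

open Classical in
lemma pathNorm_le_one (hn : 1 ≤ n) (hH : 0 < H) (hk : ∀ e, 0 ≤ k e) (hq : ∀ i, 0 ≤ q i)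
    (h : ∑ e with e ≤ v.1, k e * edgeFlow q e ^ n ≤ H) : pathNorm n H k v q ≤ 1 :=
  Real.rpow_le_one (div_nonneg (pathLoss_nonneg hk hq) hH.le) ((div_le_one hH).2 h)
    (inv_nonneg.2 (by linarith))

open Classical in
lemma pathLoss_le_of_pathNorm_le_one (hn : 1 ≤ n) (hH : 0 < H)
    (h : pathNorm n H k v q ≤ 1) :
    ∑ e with e ≤ v.1, k e * edgeFlow q e ^ n ≤ H := by
  by_contra! hc
  exact h.not_gt (Real.one_lt_rpow ((one_lt_div hH).2 hc) (inv_pos.2 (by linarith)))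

lemma pathNorm_smul (hn : 1 ≤ n) (hH : 0 < H) (hk : ∀ e, 0 ≤ k e) (hq : ∀ i, 0 ≤ q i) {c : ℝ}
    (hc : 0 ≤ c) : pathNorm n H k v (c • q) = c * pathNorm n H k v q := by
  classical
  have hsum : ∑ e with e ≤ v.1, k e * edgeFlow (c • q) e ^ n =
      c ^ n * ∑ e with e ≤ v.1, k e * edgeFlow q e ^ n := by
    rw [Finset.mul_sum]
    refine Finset.sum_congr rfl fun e _ => ?_
    rw [edgeFlow_smul, Real.mul_rpow hc (edgeFlow_nonneg hq e)]
    ring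
  rw [pathNorm, pathNorm, hsum, mul_div_assoc, Real.mul_rpow (Real.rpow_nonneg hc n)
    (div_nonneg (pathLoss_nonneg hk hq) hH.le), Real.rpow_rpow_inv hc (by linarith)]

lemma pathNorm_zero (hn : 1 ≤ n) : pathNorm n H k v 0 = 0 := by
  have h0 : ∀ e : Edge N, edgeFlow (0 : Sink N → ℝ) e = 0 := fun e => by simp [edgeFlow]
  have hn0 : n ≠ 0 := by linarith
  simp [pathNorm, h0, Real.zero_rpow hn0, Real.zero_rpow (inv_ne_zero hn0)]

/-- Minkowski's inequality along the route to `v`. -/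
lemma pathNorm_add_le (hn : 1 ≤ n) (hH : 0 < H) (hk : ∀ e, 0 ≤ k e) (hq : ∀ i, 0 ≤ q i)
    (hq' : ∀ i, 0 ≤ q' i) :
    pathNorm n H k v (q + q') ≤ pathNorm n H k v q + pathNorm n H k v q' := by
  classical
  have hn0 : n ≠ 0 := by linarith
  have ha : ∀ e, 0 ≤ k e / H := fun e => div_nonneg (hk e) hH.le
  have hnorm : ∀ p : Sink N → ℝ, (∀ i, 0 ≤ p i) → pathNorm n H k v p =
      (∑ e with e ≤ v.1, ((k e / H) ^ n⁻¹ * edgeFlow p e) ^ n) ^ (1 / n) := fun p hp => by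
    rw [pathNorm, one_div, Finset.sum_div]
    congr 1
    refine Finset.sum_congr rfl fun e _ => ?_
    rw [Real.mul_rpow (Real.rpow_nonneg (ha e) _) (edgeFlow_nonneg hp e),
      Real.rpow_inv_rpow (ha e) hn0]
    ring
  rw [hnorm q hq, hnorm q' hq', hnorm (q + q') fun i => add_nonneg (hq i) (hq' i)]
  simp only [edgeFlow_add, mul_add]
  exact Real.Lp_add_le_of_nonneg _ hn
    (fun e _ => mul_nonneg (Real.rpow_nonneg (ha e) _) (edgeFlow_nonneg hq e))
    fun e _ => mul_nonneg (Real.rpow_nonneg (ha e) _) (edgeFlow_nonneg hq' e)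

open Classical in
lemma pathNorm_single (hn : 1 ≤ n) (i : Sink N) : pathNorm n H k v (Pi.single i 1) =
    ((∑ e with e ≤ v.1 ∧ e ≤ i.1, k e) / H) ^ n⁻¹ := by
  rw [pathNorm, ← Finset.filter_filter, Finset.sum_filter (fun e => e ≤ i.1)]
  congr 2
  refine Finset.sum_congr rfl fun e _ => ?_
  rw [edgeFlow_single]
  split_ifs <;> simp [Real.zero_rpow (show n ≠ 0 by linarith)]

lemma pathCost_nonneg (hH : 0 < H) (hk : ∀ e, 0 ≤ k e) (hq : ∀ i, 0 ≤ q i) :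
    0 ≤ pathCost n H k v q := by
  classical
  exact Finset.sum_nonneg fun i _ => mul_nonneg (hq i) (pathNorm_nonneg hH hk (Sink.single_nonneg i))

lemma pathCost_add : pathCost n H k v (q + q') = pathCost n H k v q + pathCost n H k v q' := by
  simp [pathCost, add_mul, Finset.sum_add_distrib]

lemma pathCost_smul (c : ℝ) : pathCost n H k v (c • q) = c * pathCost n H k v q := by
  simp [pathCost, Finset.mul_sum, mul_assoc]

lemma pathNorm_le_pathCost (hn : 1 ≤ n) (hH : 0 < H) (hk : ∀ e, 0 ≤ k e) (hq : ∀ i, 0 ≤ q i) :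
    pathNorm n H k v q ≤ pathCost n H k v q := by
  classical
  have hdec : q = ∑ i, q i • (Pi.single i 1 : Sink N → ℝ) := by
    ext j
    simp [Finset.sum_apply, Pi.single_apply]
  have key : ∀ s : Finset (Sink N), pathNorm n H k v (∑ i ∈ s, q i • (Pi.single i 1 : Sink N → ℝ)) ≤
      ∑ i ∈ s, q i * pathNorm n H k v (Pi.single i 1) := by
    intro s
    induction s using Finset.induction_on with
    | empty => simp [pathNorm_zero hn]
    | insert i s his ih =>
      rw [Finset.sum_insert his, Finset.sum_insert his]
      have hi : ∀ j, 0 ≤ (q i • (Pi.single i 1 : Sink N → ℝ)) j := fun j =>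
        mul_nonneg (hq i) (Sink.single_nonneg i j)
      refine (pathNorm_add_le hn hH hk hi fun j => ?_).trans ?_
      · rw [Finset.sum_apply]
        exact Finset.sum_nonneg fun l _ => mul_nonneg (hq l) (Sink.single_nonneg l j)
      · rw [pathNorm_smul hn hH hk (Sink.single_nonneg i) (hq i)]
        exact add_le_add_right ih _
  calc pathNorm n H k v q = pathNorm n H k v (∑ i, q i • (Pi.single i 1 : Sink N → ℝ)) := by
        rw [← hdec]
    _ ≤ _ := key _
    _ = pathCost n H k v q := by
      unfold pathCost
      congr!

lemma pathNorm_pos (hH : 0 < H) (hk : ∀ e, 0 ≤ k e) (hq : ∀ i, 0 ≤ q i) {e : Edge N}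
    {i : Sink N} (hev : e ≤ v.1) (hei : e ≤ i.1) (hke : 0 < k e) (hqi : 0 < q i) :
    0 < pathNorm n H k v q := by
  classical
  refine Real.rpow_pos_of_pos (div_pos ?_ hH) _
  refine Finset.sum_pos' (fun f _ => mul_nonneg (hk f) (Real.rpow_nonneg (edgeFlow_nonneg hq f) n))
    ⟨e, by simpa using hev, ?_⟩
  exact mul_pos hke (Real.rpow_pos_of_pos (hqi.trans_le (le_edgeFlow hq hei)) n)

/-- Only the resistances on the route to `v` matter, and the cost increases with them. -/
lemma pathCost_mono {k' : Edge N → ℝ} {v' : Sink N} (hn : 1 ≤ n) (hH : 0 < H)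
    (hk' : ∀ e, 0 ≤ k' e) (hk : ∀ e, 0 ≤ k e) (hq : ∀ i, 0 ≤ q i)
    (h : ∀ e ≤ v.1, 0 < k e → e ≤ v'.1 ∧ k e ≤ k' e) :
    pathCost n H k v q ≤ pathCost n H k' v' q := by
  classical
  refine Finset.sum_le_sum fun i _ => mul_le_mul_of_nonneg_left ?_ (hq i)
  rw [pathNorm_single hn, pathNorm_single hn]
  refine Real.rpow_le_rpow (div_nonneg (Finset.sum_nonneg fun e _ => hk e) hH.le)
    (div_le_div_of_nonneg_right ?_ hH.le) (inv_nonneg.2 (by linarith))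
  rw [Finset.sum_filter, Finset.sum_filter]
  refine Finset.sum_le_sum fun e _ => ?_
  by_cases he : e ≤ v.1 ∧ e ≤ i.1
  · rw [if_pos he]
    rcases (hk e).eq_or_lt with h0 | h0
    · rw [← h0]
      split_ifs <;> simp [hk']
    · rw [if_pos ⟨(h e he.1 h0).1, he.2⟩]
      exact (h e he.1 h0).2
  · rw [if_neg he]
    split_ifs <;> simp [hk']

end

/-! ### Duration of a single phase -/

section

variable {n H τ : ℝ} {k r : Edge N → ℝ} {O : Set (Sink N)} {v : Sink N} {V : Sink N → ℝ}

lemma Delivers.volume_nonneg (h : Delivers n H r O τ V) (i : Sink N) : 0 ≤ V i := by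
  rcases h with ⟨hτ, q, hq, rfl⟩ | ⟨-, hV, -⟩
  exacts [mul_nonneg hτ.le (hq.1 i), hV i]

lemma mul_edgeFlow_rpow_eq_zero (hn : 1 ≤ n) {c x : ℝ} (h : c * x = 0) : c * x ^ n = 0 := by
  rcases mul_eq_zero.1 h with rfl | rfl
  · simp
  · rw [Real.zero_rpow (by linarith), mul_zero]

/-- However the valves are set, no more than the head `H` is lost along any route. -/
lemma Delivers.pathNorm_le (hn : 1 ≤ n) (hH : 0 < H) (hk : ∀ e, 0 ≤ k e) (hkr : ∀ e, k e ≤ r e)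
    (h : Delivers n H r O τ V) (v : Sink N) : pathNorm n H k v V ≤ τ := by
  classical
  rcases h with ⟨hτ, q, hq, rfl⟩ | ⟨rfl, hV, -, hr⟩
  · rw [pathNorm_smul hn hH hk hq.1 hτ.le]
    refine mul_le_of_le_one_right hτ.le (pathNorm_le_one hn hH hk hq.1 ?_)
    exact (Finset.sum_le_sum fun e _ => mul_le_mul_of_nonneg_right (hkr e)
      (Real.rpow_nonneg (edgeFlow_nonneg hq.1 e) n)).trans
      (hq.sum_loss_le hn hH.le (fun e => (hk e).trans (hkr e)) v)
  · have h0 : ∀ e, k e * edgeFlow V e ^ n = 0 := fun e =>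
      mul_edgeFlow_rpow_eq_zero hn (le_antisymm
        ((mul_le_mul_of_nonneg_right (hkr e) (edgeFlow_nonneg hV e)).trans (hr e).le)
        (mul_nonneg (hk e) (edgeFlow_nonneg hV e)))
    simp [pathNorm, h0, Real.zero_rpow (inv_ne_zero (show n ≠ 0 by linarith))]

/-- While the valve of `v` is fully open, exactly the head `H` is lost along the route to `v`. -/
lemma IsEquilibrium.pathNorm_eq_one (hH : 0 < H) {q : Sink N → ℝ}
    (hq : IsEquilibrium n H k O q) (hv : v ∈ O) : pathNorm n H k v q = 1 := by
  rw [pathNorm, hq.sum_loss hv, div_self hH.ne', Real.one_rpow]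

lemma Delivers.le_pathCost (hn : 1 ≤ n) (hH : 0 < H) (hk : ∀ e, 0 ≤ k e)
    (h : Delivers n H k O τ V) (hv : v ∈ O) : τ ≤ pathCost n H k v V := by
  rcases h with ⟨hτ, q, hq, rfl⟩ | ⟨rfl, hV, -⟩
  · rw [pathCost_smul]
    refine le_mul_of_one_le_right hτ.le ?_
    rw [← hq.pathNorm_eq_one hH hv]
    exact pathNorm_le_pathCost hn hH hk hq.1
  · exact pathCost_nonneg hH hk hV

/-- If all resistances lie on the route to `v`, then in any discrete state the flow leaves that
route at a single point only (up to edges of resistance zero), so that the flow rates have path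
cost at most one. -/
lemma IsEquilibrium.pathCost_le_one (hn : 1 ≤ n) (hH : 0 < H) (hk : ∀ e, 0 ≤ k e)
    (hoff : ∀ e, ¬ e ≤ v.1 → k e = 0) {q : Sink N → ℝ} (hq : IsEquilibrium n H k O q) :
    pathCost n H k v q ≤ 1 := by
  classical
  by_cases hex : ∃ i, 0 < q i
  swap
  · push Not at hex
    refine (Finset.sum_nonpos fun i _ => ?_).trans zero_le_one
    rw [le_antisymm (hex i) (hq.1 i), zero_mul]
  -- among the sinks with a positive flow, `i` branches off the route to `v` first
  obtain ⟨i, hi, himin⟩ := Finset.exists_min_image {i | 0 < q i}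
    (fun i : Sink N => (Finset.univ.filter fun e : Edge N => e ≤ v.1 ∧ e ≤ i.1).card)
    (by simpa [Finset.Nonempty] using hex)
  have hi0 : 0 < q i := by simpa using hi
  have hO : ∀ j, 0 < q j → j ∈ O := fun j hj => by
    by_contra hc
    exact hj.ne' (hq.2.1 j hc)
  have hsub : ∀ j, 0 < q j → ∀ e, e ≤ v.1 → e ≤ i.1 → e ≤ j.1 := by
    intro j hj e hev hei
    by_contra hej
    refine (himin j (by simpa using hj)).not_gt (Finset.card_lt_card ?_)
    refine (Finset.ssubset_iff_of_subset fun f hf => ?_).2 ⟨e, by simp [hev, hei], by simp [hej]⟩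
    simp only [Finset.mem_filter, Finset.mem_univ, true_and] at hf ⊢
    refine ⟨hf.1, ?_⟩
    rcases Edge.le_total_of_le hev hf.1 with h | h
    · exact absurd (h.trans hf.2) hej
    · exact h.trans hei
  have hloss : ∀ j, 0 < q j → ∑ e with e ≤ v.1 ∧ e ≤ j.1, k e * edgeFlow q e ^ n = H := by
    intro j hj
    rw [← hq.sum_loss (hO j hj), Finset.sum_filter, Finset.sum_filter]
    refine Finset.sum_congr rfl fun e _ => ?_
    by_cases hev : e ≤ v.1
    · simp [hev]
    · simp [hev, hoff e hev]
  have htot : ∀ e, e ≤ v.1 → e ≤ i.1 → edgeFlow q e = ∑ j, q j := fun e hev hei => by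
    refine Finset.sum_congr rfl fun j _ => ?_
    rcases (hq.1 j).eq_or_lt with h | h
    · simp [← h]
    · rw [if_pos (hsub j h e hev hei)]
  -- beyond the point where `i` branches off, only edges of resistance zero carry a flow
  have hres : ∀ j, 0 < q j →
      ∑ e with e ≤ v.1 ∧ e ≤ j.1, k e = ∑ e with e ≤ v.1 ∧ e ≤ i.1, k e := by
    intro j hj
    have hss : Finset.univ.filter (fun e : Edge N => e ≤ v.1 ∧ e ≤ i.1) ⊆
        Finset.univ.filter fun e : Edge N => e ≤ v.1 ∧ e ≤ j.1 := fun e he => by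
      simp only [Finset.mem_filter, Finset.mem_univ, true_and] at he ⊢
      exact ⟨he.1, hsub j hj e he.1 he.2⟩
    have h1 := Finset.sum_sdiff (f := fun e => k e * edgeFlow q e ^ n) hss
    rw [hloss i hi0, hloss j hj, add_eq_right, Finset.sum_eq_zero_iff_of_nonneg fun e _ =>
      mul_nonneg (hk e) (Real.rpow_nonneg (edgeFlow_nonneg hq.1 e) n)] at h1
    rw [← Finset.sum_sdiff hss, add_eq_right]
    refine Finset.sum_eq_zero fun e he => ?_
    have hej : e ≤ j.1 := (Finset.mem_filter.1 (Finset.mem_sdiff.1 he).1).2.2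
    exact (mul_eq_zero.1 (h1 e he)).resolve_right
      (Real.rpow_pos_of_pos (hj.trans_le (le_edgeFlow hq.1 hej)) n).ne'
  set R := ∑ e with e ≤ v.1 ∧ e ≤ i.1, k e with hR
  have hQ : 0 ≤ ∑ j, q j := Finset.sum_nonneg fun j _ => hq.1 j
  have hRQ : (∑ j, q j) ^ n * (R / H) = 1 := by
    rw [← mul_div_assoc, div_eq_one_iff_eq hH.ne', ← hloss i hi0, hR, Finset.mul_sum]
    refine Finset.sum_congr rfl fun e he => ?_
    obtain ⟨-, hev, hei⟩ := Finset.mem_filter.1 he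
    rw [htot e hev hei, mul_comm]
  have hcost : pathCost n H k v q = (∑ j, q j) * (R / H) ^ n⁻¹ := by
    rw [Finset.sum_mul]
    refine Finset.sum_congr rfl fun j _ => ?_
    rcases (hq.1 j).eq_or_lt with h | h
    · simp [← h]
    · rw [pathNorm_single hn, hres j h]
  have hR0 : 0 ≤ R / H := div_nonneg (Finset.sum_nonneg fun e _ => hk e) hH.le
  rw [hcost, ← Real.rpow_rpow_inv hQ (show n ≠ 0 by linarith), ← Real.mul_rpow
    (Real.rpow_nonneg hQ n) hR0, hRQ, Real.one_rpow]

lemma Delivers.pathCost_le (hn : 1 ≤ n) (hH : 0 < H) (hk : ∀ e, 0 ≤ k e)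
    (hoff : ∀ e, ¬ e ≤ v.1 → k e = 0) (h : Delivers n H k O τ V) : pathCost n H k v V ≤ τ := by
  classical
  rcases h with ⟨hτ, q, hq, rfl⟩ | ⟨rfl, hV, -, h0⟩
  · rw [pathCost_smul]
    exact mul_le_of_le_one_right hτ.le (hq.pathCost_le_one hn hH hk hoff)
  · refine Finset.sum_nonpos fun i _ => ?_
    rcases (hV i).eq_or_lt with hi | hi
    · simp [← hi]
    · rw [pathNorm_single hn, Finset.sum_eq_zero, zero_div,
        Real.zero_rpow (inv_ne_zero (by linarith)), mul_zero]
      intro e he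
      exact (mul_eq_zero.1 (h0 e)).resolve_right
        (hi.trans_le (le_edgeFlow hV (Finset.mem_filter.1 he).2.2)).ne'

end

/-! ### Durations of schedules -/

section

variable {n H T : ℝ} {k : Edge N → ℝ} {v : Sink N} {D : Sink N → ℝ}

lemma pathCost_le_of_mem_discreteTimes (hn : 1 ≤ n) (hH : 0 < H) (hk : ∀ e, 0 ≤ k e)
    (hoff : ∀ e, ¬ e ≤ v.1 → k e = 0) (h : T ∈ discreteTimes n H k D) :
    pathCost n H k v D ≤ T := by
  obtain ⟨L, hL, rfl, rfl⟩ := h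
  induction L with
  | nil => simp [pathCost]
  | cons p L ih =>
    obtain ⟨hr, hp⟩ := hL p List.mem_cons_self
    rw [hr] at hp
    simp only [List.map_cons, List.sum_cons, pathCost_add]
    exact add_le_add (hp.pathCost_le hn hH hk hoff)
      (ih fun p hp => hL p (List.mem_cons_of_mem _ hp))

lemma pathNorm_le_of_mem_continuousTimes (hn : 1 ≤ n) (hH : 0 < H) (hk : ∀ e, 0 ≤ k e)
    (h : T ∈ continuousTimes n H k D) (v : Sink N) : pathNorm n H k v D ≤ T := by
  obtain ⟨L, hL, rfl, rfl⟩ := h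
  have hnn : ∀ L : List (Phase N), (∀ p ∈ L, IsContinuousPhase n H k p) →
      ∀ i, 0 ≤ (L.map Phase.volume).sum i := by
    intro L hL i
    induction L with
    | nil => simp
    | cons p L ih =>
      simp only [List.map_cons, List.sum_cons, Pi.add_apply]
      exact add_nonneg ((hL p List.mem_cons_self).2.volume_nonneg i)
        (ih fun p hp => hL p (List.mem_cons_of_mem _ hp))
  induction L with
  | nil => simp [pathNorm_zero hn]
  | cons p L ih =>
    obtain ⟨hr, hp⟩ := hL p List.mem_cons_self
    have hL' : ∀ p ∈ L, IsContinuousPhase n H k p := fun p hp => hL p (List.mem_cons_of_mem _ hp)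
    simp only [List.map_cons, List.sum_cons]
    exact (pathNorm_add_le hn hH hk hp.volume_nonneg (hnn L hL')).trans
      (add_le_add (hp.pathNorm_le hn hH hk (fun e => (hr e).1) v) (ih hL'))

lemma ScheduleS.mem_discreteTimes (h : ScheduleS n H k D T v) : T ∈ discreteTimes n H k D := by
  induction h with
  | @last d τ v hd hv =>
    exact ⟨[⟨k, {i | 0 < d i}, τ, d⟩], by simpa [IsDiscretePhase] using hd, by simp, by simp⟩
  | @step d V τ T v hV hle hex hS ih =>
    obtain ⟨L, hL, hvol, hdur⟩ := ih
    refine ⟨⟨k, {i | 0 < d i}, τ, V⟩ :: L, ?_, by simp [hvol], by simp [hdur]⟩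
    intro p hp
    rcases List.mem_cons.1 hp with rfl | hp
    · exact ⟨rfl, hV⟩
    · exact hL p hp

lemma ScheduleS.demand_pos (h : ScheduleS n H k D T v) : 0 < D v := by
  induction h with
  | last hd hv => exact hv
  | @step d V τ T v hV hle hex hS ih => exact (sub_pos.1 ih).trans_le' (hV.volume_nonneg v)

/-- As the valve of `v` is open all the time, the time is at most the path cost for `v`. -/
lemma ScheduleS.le_pathCost (hn : 1 ≤ n) (hH : 0 < H) (hk : ∀ e, 0 ≤ k e)
    (h : ScheduleS n H k D T v) : T ≤ pathCost n H k v D := by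
  induction h with
  | @last d τ v hd hv => exact hd.le_pathCost hn hH hk hv
  | @step d V τ T v hV hle hex hS ih =>
    have hv : 0 < d v := (sub_pos.1 hS.demand_pos).trans_le' (hV.volume_nonneg v)
    have := pathCost_add (n := n) (H := H) (k := k) (v := v) (q := V) (q' := d - V)
    rw [add_sub_cancel] at this
    rw [this]
    exact add_le_add (hV.le_pathCost hn hH hk hv) ih

lemma IsEquilibrium.exists_resistance_pos {O : Set (Sink N)} {q : Sink N → ℝ} (hH : 0 < H)
    (hk : ∀ e, 0 ≤ k e) (hq : IsEquilibrium n H k O q) (hv : v ∈ O) :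
    ∃ e ≤ v.1, 0 < k e := by
  classical
  by_contra! hc
  refine hH.ne' ((hq.sum_loss hv).symm.trans (Finset.sum_eq_zero fun e he => ?_))
  rw [le_antisymm (hc e (Finset.mem_filter.1 he).2) (hk e), zero_mul]

/-- Sinks on routes of zero resistance are served in zero time, before any other sink gets
anything; so the last valve to be closed has a route of positive resistance. -/
lemma ScheduleS.exists_resistance_pos (hH : 0 < H) (hk : ∀ e, 0 ≤ k e)
    (h : ScheduleS n H k D T v) (hD : ∃ i, 0 < D i ∧ ∃ e : Edge N, e ≤ i.1 ∧ 0 < k e) :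
    ∃ e ≤ v.1, 0 < k e := by
  have hzero : ∀ {V : Sink N → ℝ} {i : Sink N} {e : Edge N}, (∀ i, 0 ≤ V i) →
      (∀ e, k e * edgeFlow V e = 0) → e ≤ i.1 → 0 < k e → V i = 0 := fun {V i e} hV h0 hei hke =>
    le_antisymm ((le_edgeFlow hV hei).trans_eq ((mul_eq_zero.1 (h0 e)).resolve_left hke.ne')) (hV i)
  induction h with
  | @last d τ v hd hv =>
    rcases hd with ⟨-, q, hq, -⟩ | ⟨-, hV, -, h0⟩
    · exact hq.exists_resistance_pos hH hk hv
    · obtain ⟨i, hi, e, hei, hke⟩ := hD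
      exact absurd (hzero hV h0 hei hke) hi.ne'
  | @step d V τ T v hV hle hex hS ih =>
    have hv : 0 < d v := (sub_pos.1 hS.demand_pos).trans_le' (hV.volume_nonneg v)
    rcases hV with ⟨-, q, hq, -⟩ | ⟨-, hV, -, h0⟩
    · exact hq.exists_resistance_pos hH hk hv
    · obtain ⟨i, hi, e, hei, hke⟩ := hD
      exact ih ⟨i, by simpa [hzero hV h0 hei hke] using hi, e, hei, hke⟩

/-! ### Throttling with continuous valves -/

lemma IsUnitDemand.mem_continuousTimes (h : IsUnitDemand n H k D) :
    1 ∈ continuousTimes n H k D := by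
  obtain ⟨r, O, hr, hd⟩ := h
  exact ⟨[⟨r, O, 1, D⟩], by simpa [IsContinuousPhase] using ⟨hr, hd⟩, by simp, by simp⟩

lemma IsUnitDemand.pathNorm_le_one (hn : 1 ≤ n) (hH : 0 < H) (hk : ∀ e, 0 ≤ k e)
    (h : IsUnitDemand n H k D) (v : Sink N) : pathNorm n H k v D ≤ 1 :=
  pathNorm_le_of_mem_continuousTimes hn hH hk h.mem_continuousTimes v

/-- If all resistances lie on the route to `v`, continuous valves can throttle every sink to the
desired flow rate as long as no more than the head `H` is lost along that route. -/
lemma exists_isEquilibrium_of_pathNorm_le_one (hn : 1 ≤ n) (hH : 0 < H) (hk : ∀ e, 0 ≤ k e)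
    (hoff : ∀ e, ¬ e ≤ v.1 → k e = 0) {q : Sink N → ℝ} (hq : ∀ i, 0 ≤ q i)
    (h : pathNorm n H k v q ≤ 1) :
    ∃ r O, IsSetting k r ∧ IsEquilibrium n H r O q := by
  classical
  have hloss := pathLoss_le_of_pathNorm_le_one hn hH h
  have hloss0 : ∀ e, 0 ≤ k e * edgeFlow q e ^ n := fun e =>
    mul_nonneg (hk e) (Real.rpow_nonneg (edgeFlow_nonneg hq e) n)
  -- the head at an inner vertex
  set g : N → ℝ := fun u => H - ∑ e : Edge N with e.1 ≤ u, k e * edgeFlow q e ^ n with hg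
  have hgpred : ∀ e : Edge N, g (Order.pred e.1) = g e.1 + k e * edgeFlow q e ^ n := fun e => by
    have := sum_edge_le_eq_pred_add (fun e => k e * edgeFlow q e ^ n) e
    simp only [hg]
    linarith
  have hg0 : ∀ u, 0 ≤ g u := fun u => by
    refine sub_nonneg.2 (le_trans ?_ hloss)
    rw [Finset.sum_filter, Finset.sum_filter]
    refine Finset.sum_le_sum fun e _ => ?_
    by_cases hev : e ≤ v.1
    · rw [if_pos hev]
      split_ifs
      exacts [le_rfl, hloss0 e]
    · simp [hoff e hev]
  refine ⟨fun e => if IsMax e.1 ∧ 0 < edgeFlow q e then g (Order.pred e.1) / edgeFlow q e ^ n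
    else k e, {i | 0 < q i}, fun e => ⟨?_, fun he => if_neg fun h => he h.1⟩, hq,
    fun i hi => le_antisymm (not_lt.1 hi) (hq i), fun u => if IsMax u then 0 else g u, ?_, ?_, ?_⟩
  · dsimp only
    split_ifs with he
    · rw [le_div_iff₀ (Real.rpow_pos_of_pos he.2 n), hgpred e]
      exact le_add_of_nonneg_left (hg0 e.1)
    · exact le_rfl
  · have hbot : ¬ IsMax (⊥ : N) := fun hmax =>
      v.1.2 (le_bot_iff.1 (hmax bot_le))
    simp only [hg, if_neg hbot]
    rw [Finset.filter_false_of_mem fun e _ he => e.2 (le_bot_iff.1 he), Finset.sum_empty, sub_zero]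
  · exact fun i => if_pos i.2
  · intro e he
    have hpred : ¬ IsMax (Order.pred e.1) := (Edge.pred_lt e).not_isMax
    dsimp only
    rw [if_neg hpred]
    by_cases hmax : IsMax e.1
    · have hpos : 0 < edgeFlow q e := by
        rw [show e = (⟨e, hmax⟩ : Sink N).1 from rfl, edgeFlow_sink]
        exact he hmax
      rw [if_pos hmax, if_pos ⟨hmax, hpos⟩, div_mul_cancel₀ _ (Real.rpow_pos_of_pos hpos n).ne',
        sub_zero]
    · rw [if_neg hmax, if_neg fun h => hmax h.1, hgpred e, add_sub_cancel_left]

lemma isUnitDemand_of_pathNorm_le_one (hn : 1 ≤ n) (hH : 0 < H) (hk : ∀ e, 0 ≤ k e)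
    (hoff : ∀ e, ¬ e ≤ v.1 → k e = 0) (hD : ∀ i, 0 ≤ D i) (h : pathNorm n H k v D ≤ 1) :
    IsUnitDemand n H k D := by
  obtain ⟨r, O, hr, hq⟩ := exists_isEquilibrium_of_pathNorm_le_one hn hH hk hoff hD h
  exact ⟨r, O, hr, Or.inl ⟨one_pos, D, hq, (one_smul ℝ D).symm⟩⟩

lemma pathNorm_inv_smul_self (hn : 1 ≤ n) (hH : 0 < H) (hk : ∀ e, 0 ≤ k e) (hD : ∀ i, 0 ≤ D i)
    (h0 : 0 < pathNorm n H k v D) : pathNorm n H k v ((pathNorm n H k v D)⁻¹ • D) = 1 := by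
  rw [pathNorm_smul hn hH hk hD (inv_nonneg.2 h0.le), inv_mul_cancel₀ h0.ne']

lemma pathNorm_mem_continuousTimes (hn : 1 ≤ n) (hH : 0 < H) (hk : ∀ e, 0 ≤ k e)
    (hoff : ∀ e, ¬ e ≤ v.1 → k e = 0) (hD : ∀ i, 0 ≤ D i) (h0 : 0 < pathNorm n H k v D) :
    pathNorm n H k v D ∈ continuousTimes n H k D := by
  set c := pathNorm n H k v D with hc
  have hq : ∀ i, 0 ≤ (c⁻¹ • D) i := fun i => mul_nonneg (inv_nonneg.2 h0.le) (hD i)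
  obtain ⟨r, O, hr, hq⟩ := exists_isEquilibrium_of_pathNorm_le_one hn hH hk hoff hq
    (pathNorm_inv_smul_self hn hH hk hD h0).le
  refine ⟨[⟨r, O, c, D⟩], ?_, by simp, by simp⟩
  intro p hp
  rw [List.mem_singleton.1 hp]
  exact ⟨hr, Or.inl ⟨h0, _, hq, (smul_inv_smul₀ h0.ne' D).symm⟩⟩

end

/-! ### Existence of equilibria -/

section

variable {n H : ℝ} {k : Edge N → ℝ}

open Classical in
/-- Flow rates that lose exactly the head `H` on the route to every open sink are in equilibrium. -/
lemma isEquilibrium_of_sum_loss {O : Set (Sink N)} (hO : O.Nonempty) {q : Sink N → ℝ}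
    (hq : ∀ i, 0 ≤ q i) (hqO : ∀ i, i ∉ O → q i = 0)
    (h : ∀ i ∈ O, ∑ e with e ≤ i.1, k e * edgeFlow q e ^ n = H) : IsEquilibrium n H k O q := by
  obtain ⟨v, -⟩ := hO
  set g : N → ℝ := fun u => H - ∑ e : Edge N with e.1 ≤ u, k e * edgeFlow q e ^ n with hg
  refine ⟨hq, hqO, fun u => if IsMax u then 0 else g u, ?_, fun i => if_pos i.2, fun e he => ?_⟩
  · have hbot : ¬ IsMax (⊥ : N) := fun hmax => v.1.2 (le_bot_iff.1 (hmax bot_le))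
    simp only [hg, if_neg hbot]
    rw [Finset.filter_false_of_mem fun e _ he => e.2 (le_bot_iff.1 he), Finset.sum_empty, sub_zero]
  · have hpred : ¬ IsMax (Order.pred e.1) := (Edge.pred_lt e).not_isMax
    have hsum := sum_edge_le_eq_pred_add (fun e => k e * edgeFlow q e ^ n) e
    dsimp only
    rw [if_neg hpred]
    by_cases hmax : IsMax e.1
    · have := h _ (he hmax)
      rw [if_pos hmax]
      simp only [hg, Subtype.coe_le_coe] at hsum ⊢
      simp only at this
      linarith
    · rw [if_neg hmax]
      simp only [hg]
      linarith

lemma continuous_edgeFlow (e : Edge N) : Continuous fun q : Sink N → ℝ => edgeFlow q e :=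
  continuous_finsetSum _ fun i _ => by split_ifs <;> fun_prop

open Classical in
/-- A distribution of a unit of flow among the open sinks that minimises the dissipated power
`∑ k Q ^ (n + 1)` loses the same head on the routes to all sinks that are supplied, and no less on
the routes to the other open sinks: otherwise some flow could be shifted with a gain. -/
lemma exists_minimal_dissipation (hn : 1 ≤ n) {O : Set (Sink N)} (hO : O.Nonempty) :
    ∃ q : Sink N → ℝ, (∀ i, 0 ≤ q i) ∧ (∀ i, i ∉ O → q i = 0) ∧ ∑ i, q i = 1 ∧
      ∀ i j, 0 < q i → j ∈ O →
        ∑ e with e ≤ i.1, k e * edgeFlow q e ^ n ≤ ∑ e with e ≤ j.1, k e * edgeFlow q e ^ n := by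
  set S : Set (Sink N → ℝ) := stdSimplex ℝ (Sink N) ∩ {q | ∀ i, i ∉ O → q i = 0} with hS
  set Φ : (Sink N → ℝ) → ℝ := fun q => ∑ e, k e * edgeFlow q e ^ (n + 1) with hΦ
  have hcompact : IsCompact S := by
    refine (isCompact_stdSimplex ℝ (Sink N)).inter_right ?_
    simp only [Set.ofPred_forall]
    exact isClosed_iInter fun i => isClosed_iInter fun _ =>
      isClosed_eq (continuous_apply i) continuous_const
  have hne : S.Nonempty := by
    obtain ⟨v, hv⟩ := hO
    refine ⟨Pi.single v 1, single_mem_stdSimplex ℝ v, fun i hi => ?_⟩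
    rw [Pi.single_apply, if_neg]
    rintro rfl
    exact hi hv
  have hcont : ContinuousOn Φ S := by
    refine Continuous.continuousOn (continuous_finsetSum _ fun e _ => continuous_const.mul ?_)
    exact (continuous_edgeFlow e).rpow_const fun _ => Or.inr (by linarith)
  obtain ⟨q, ⟨⟨hq0, hq1⟩, hqO⟩, hmin⟩ := hcompact.exists_isMinOn hne hcont
  refine ⟨q, hq0, hqO, hq1, fun i j hi hj => ?_⟩
  have hiO : i ∈ O := by
    by_contra hc
    exact hi.ne' (hqO i hc)
  -- the change of the flow in `e` when flow is shifted from `i` to `j`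
  set s : Edge N → ℝ := fun e => (if e ≤ j.1 then 1 else 0) - if e ≤ i.1 then 1 else 0 with hs
  have hflow : ∀ (t : ℝ) e, edgeFlow (q + t • (Pi.single j 1 - Pi.single i 1)) e =
      edgeFlow q e + t * s e := fun t e => by
    rw [sub_eq_add_neg, ← neg_one_smul ℝ, edgeFlow_add, edgeFlow_smul, edgeFlow_add, edgeFlow_smul,
      edgeFlow_single, edgeFlow_single]
    ring
  have hderiv : HasDerivAt (fun t : ℝ => Φ (q + t • (Pi.single j 1 - Pi.single i 1)))
      (∑ e, k e * (s e * (n + 1) * edgeFlow q e ^ n)) 0 := by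
    simp only [hΦ, hflow]
    refine HasDerivAt.fun_sum fun e _ => HasDerivAt.const_mul (k e) ?_
    have h1 : HasDerivAt (fun t : ℝ => edgeFlow q e + t * s e) (s e) 0 := by
      simpa using ((hasDerivAt_id (0 : ℝ)).mul_const (s e)).const_add (edgeFlow q e)
    simpa using h1.rpow_const (p := n + 1) (Or.inr (by linarith))
  have hnonneg : 0 ≤ ∑ e, k e * (s e * (n + 1) * edgeFlow q e ^ n) := by
    refine ge_of_tendsto hderiv.tendsto_slope_zero_right ?_
    filter_upwards [Ioo_mem_nhdsGT hi] with t ht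
    refine smul_nonneg (inv_nonneg.2 ht.1.le) (sub_nonneg.2 ?_)
    simp only [zero_smul, add_zero, zero_add]
    refine hmin ⟨⟨fun l => ?_, ?_⟩, fun l hl => ?_⟩
    · simp only [Pi.add_apply, Pi.smul_apply, Pi.sub_apply, Pi.single_apply, smul_eq_mul]
      have := hq0 l
      have := ht.1
      have := ht.2
      split_ifs with h1 h2 h2
      · linarith
      · linarith
      · subst h2
        linarith
      · linarith
    · simp [Finset.sum_add_distrib, ← Finset.mul_sum, hq1]
    · have hlj : l ≠ j := fun h => hl (h ▸ hj)
      have hli : l ≠ i := fun h => hl (h ▸ hiO)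
      simp [hqO l hl, hlj, hli]
  have hval : ∑ e, k e * (s e * (n + 1) * edgeFlow q e ^ n) = (n + 1) *
      (∑ e with e ≤ j.1, k e * edgeFlow q e ^ n - ∑ e with e ≤ i.1, k e * edgeFlow q e ^ n) := by
    rw [Finset.sum_filter, Finset.sum_filter, ← Finset.sum_sub_distrib, Finset.mul_sum]
    refine Finset.sum_congr rfl fun e _ => ?_
    simp only [hs]
    split_ifs <;> ring
  rw [hval] at hnonneg
  exact sub_nonneg.1 ((mul_nonneg_iff_of_pos_left (by linarith)).1 hnonneg)

lemma exists_isEquilibrium (hn : 1 ≤ n) (hH : 0 < H) (hk : ∀ e, 0 ≤ k e) {O : Set (Sink N)}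
    (hO : O.Nonempty) (hpos : ∀ i ∈ O, ∃ e ≤ i.1, 0 < k e) : ∃ q, IsEquilibrium n H k O q := by
  classical
  obtain ⟨q, hq0, hqO, hq1, hle⟩ := exists_minimal_dissipation (k := k) hn hO
  obtain ⟨i, hi⟩ : ∃ i, 0 < q i := by
    by_contra! hc
    linarith [Finset.sum_nonpos fun i (_ : i ∈ Finset.univ) => hc i]
  have hiO : i ∈ O := by
    by_contra hc
    exact hi.ne' (hqO i hc)
  set c := ∑ e with e ≤ i.1, k e * edgeFlow q e ^ n with hc
  have hc0 : 0 < c := by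
    obtain ⟨e, hei, hke⟩ := hpos i hiO
    refine Finset.sum_pos' (fun f _ => mul_nonneg (hk f)
      (Real.rpow_nonneg (edgeFlow_nonneg hq0 f) n)) ⟨e, by simpa using hei, ?_⟩
    exact mul_pos hke (Real.rpow_pos_of_pos (hi.trans_le (le_edgeFlow hq0 hei)) n)
  have heq : ∀ j ∈ O, ∑ e with e ≤ j.1, k e * edgeFlow q e ^ n = c := fun j hj =>
    le_antisymm (sum_loss_le_of_supplied hn hc0.le hk hq0 (fun l hl => hle l i hl hiO) j)
      (hle i j hi hj)
  have ha : 0 ≤ (H / c) ^ n⁻¹ := Real.rpow_nonneg (div_nonneg hH.le hc0.le) _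
  refine ⟨(H / c) ^ n⁻¹ • q, isEquilibrium_of_sum_loss hO (fun j => mul_nonneg ha (hq0 j))
    (fun j hj => by simp [hqO j hj]) fun j hj => ?_⟩
  calc ∑ e with e ≤ j.1, k e * edgeFlow ((H / c) ^ n⁻¹ • q) e ^ n
      = ∑ e with e ≤ j.1, H / c * (k e * edgeFlow q e ^ n) := by
        refine Finset.sum_congr rfl fun e _ => ?_
        rw [edgeFlow_smul, Real.mul_rpow ha (edgeFlow_nonneg hq0 e),
          Real.rpow_inv_rpow (div_nonneg hH.le hc0.le) (by linarith)]
        ring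
    _ = H := by rw [← Finset.mul_sum, heq j hj, div_mul_cancel₀ _ hc0.ne']

/-! ### Executing the schedule -/

/-- With all unsatisfied sinks open, the network can run until the first valve is closed. If some of
these sinks have a route of zero resistance, the first phase takes no time and serves just them. -/
lemma exists_first_phase (hn : 1 ≤ n) (hH : 0 < H) (hk : ∀ e, 0 ≤ k e) {d : Sink N → ℝ}
    (hd : ∀ i, 0 ≤ d i) (hex : ∃ i, 0 < d i) :
    ∃ τ V, Delivers n H k {i | 0 < d i} τ V ∧ (∀ i, V i ≤ d i) ∧ ∃ i, 0 < d i ∧ V i = d i := by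
  classical
  by_cases hpos : ∀ i ∈ {i | 0 < d i}, ∃ e ≤ i.1, 0 < k e
  · obtain ⟨q, hq⟩ := exists_isEquilibrium hn hH hk hex hpos
    have hqd : ∀ i, 0 < q i → 0 < d i := fun i hi => by
      by_contra hc
      exact hi.ne' (hq.2.1 i hc)
    have hqex : (Finset.univ.filter fun i => 0 < q i).Nonempty := by
      by_contra hc
      have h0 : ∀ i, q i = 0 := fun i => le_antisymm
        (not_lt.1 fun hi => hc ⟨i, by simpa using hi⟩) (hq.1 i)
      obtain ⟨i, hi⟩ := hex
      have := hq.sum_loss hi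
      simp [edgeFlow, h0, Real.zero_rpow (show n ≠ 0 by linarith)] at this
      exact hH.ne this
    obtain ⟨i, hi, himin⟩ := Finset.exists_min_image _ (fun i => d i / q i) hqex
    have hi0 : 0 < q i := by simpa using hi
    have hτ : 0 < d i / q i := div_pos (hqd i hi0) hi0
    refine ⟨d i / q i, (d i / q i) • q, Or.inl ⟨hτ, q, hq, rfl⟩, fun j => ?_, i, hqd i hi0,
      div_mul_cancel₀ _ hi0.ne'⟩
    rcases (hq.1 j).eq_or_lt with h | h
    · simpa [← h] using hd j
    · exact (le_div_iff₀ h).1 (himin j (by simpa using h))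
  · push Not at hpos
    obtain ⟨v, hv, hv0⟩ := hpos
    set V : Sink N → ℝ := fun i => if ∃ e ≤ i.1, 0 < k e then 0 else d i with hV
    have hVv : V v = d v := if_neg (by simpa using hv0)
    refine ⟨0, V, Or.inr ⟨rfl, fun i => ?_, fun i hi => ?_, fun e => ?_⟩, fun i => ?_, v, hv, hVv⟩
    · simp only [hV]
      split_ifs
      exacts [le_rfl, hd i]
    · simp only [hV]
      split_ifs
      exacts [rfl, le_antisymm (not_lt.1 hi) (hd i)]
    · rcases (hk e).eq_or_lt with h | h
      · rw [← h, zero_mul]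
      · refine mul_eq_zero_of_right _ (Finset.sum_eq_zero fun i _ => ?_)
        split_ifs with hei
        · exact if_pos ⟨e, hei, h⟩
        · rfl
    · simp only [hV]
      split_ifs
      exacts [hd i, le_rfl]

lemma exists_scheduleS (hn : 1 ≤ n) (hH : 0 < H) (hk : ∀ e, 0 ≤ k e) {d : Sink N → ℝ}
    (hd : ∀ i, 0 ≤ d i) (hex : ∃ i, 0 < d i) : ∃ T v, ScheduleS n H k d T v := by
  classical
  induction hm : (Finset.univ.filter fun i => 0 < d i).card using Nat.strong_induction_on
    generalizing d with
  | _ m ih =>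
    obtain ⟨τ, V, hV, hle, hsat⟩ := exists_first_phase hn hH hk hd hex
    by_cases hrest : ∃ i, 0 < (d - V) i
    · obtain ⟨i, hi, hVi⟩ := hsat
      obtain ⟨T, v, hS⟩ := ih _ (by
        rw [← hm]
        refine Finset.card_lt_card ((Finset.ssubset_iff_of_subset fun j hj => ?_).2
          ⟨i, by simpa using hi, by simp [hVi]⟩)
        simp only [Finset.mem_filter, Finset.mem_univ, true_and, sub_pos] at hj ⊢
        exact hj.trans_le' (hV.volume_nonneg j)) (fun j => sub_nonneg.2 (hle j)) hrest rfl
      exact ⟨τ + T, v, ScheduleS.step hV hle ⟨i, hi, hVi⟩ hS⟩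
    · push Not at hrest
      obtain rfl : V = d := funext fun i => le_antisymm (hle i) (sub_nonpos.1 (hrest i))
      obtain ⟨v, hv⟩ := hex
      exact ⟨τ, v, ScheduleS.last hV hv⟩

end

/-! ### Passing to the main path -/

section

variable {n H T : ℝ} {k : Edge N → ℝ} {v : Sink N} {D : Sink N → ℝ}

lemma minDiscreteTime_le (h : T ∈ discreteTimes n H k D) :
    minDiscreteTime n H k D ≤ ENNReal.ofReal T :=
  iInf₂_le T h

lemma minContinuousTime_le (h : T ∈ continuousTimes n H k D) :
    minContinuousTime n H k D ≤ ENNReal.ofReal T :=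
  iInf₂_le T h

lemma pathCost_le_minDiscreteTime (hn : 1 ≤ n) (hH : 0 < H) (hk : ∀ e, 0 ≤ k e)
    (hoff : ∀ e, ¬ e ≤ v.1 → k e = 0) :
    ENNReal.ofReal (pathCost n H k v D) ≤ minDiscreteTime n H k D :=
  le_iInf₂ fun _ h => ENNReal.ofReal_le_ofReal (pathCost_le_of_mem_discreteTimes hn hH hk hoff h)

lemma pathNorm_le_minContinuousTime (hn : 1 ≤ n) (hH : 0 < H) (hk : ∀ e, 0 ≤ k e) (v : Sink N) :
    ENNReal.ofReal (pathNorm n H k v D) ≤ minContinuousTime n H k D :=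
  le_iInf₂ fun _ h => ENNReal.ofReal_le_ofReal (pathNorm_le_of_mem_continuousTimes hn hH hk h v)

lemma pathNorm_mainPathNetwork (q : Sink N → ℝ) :
    pathNorm n H (mainPathNetwork k v) v q = pathNorm n H k v q := by
  classical
  unfold pathNorm
  congr 2
  exact Finset.sum_congr rfl fun e he => by rw [mainPathNetwork_of_le (Finset.mem_filter.1 he).2]

lemma pathCost_mainPathNetwork (q : Sink N → ℝ) :
    pathCost n H (mainPathNetwork k v) v q = pathCost n H k v q := by
  simp only [pathCost, pathNorm_mainPathNetwork]

lemma ScheduleS.pathNorm_pos (hH : 0 < H) (hI : IsInstance k D) (h : ScheduleS n H k D T v) :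
    0 < pathNorm n H k v D := by
  obtain ⟨e, he, hke⟩ := h.exists_resistance_pos hH hI.1 hI.2.2
  exact SupplyNetwork.pathNorm_pos hH hI.1 hI.2.1 he he hke h.demand_pos

lemma ScheduleS.isInstance_mainPathNetwork (hH : 0 < H) (hI : IsInstance k D)
    (h : ScheduleS n H k D T v) : IsInstance (mainPathNetwork k v) D := by
  obtain ⟨e, he, hke⟩ := h.exists_resistance_pos hH hI.1 hI.2.2
  exact ⟨mainPathNetwork_nonneg hI.1, hI.2.1, v, h.demand_pos, e, he,
    by rwa [mainPathNetwork_of_le he]⟩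

lemma ScheduleS.minDiscreteTime_le_pathCost (hn : 1 ≤ n) (hH : 0 < H) (hk : ∀ e, 0 ≤ k e)
    (h : ScheduleS n H k D T v) :
    minDiscreteTime n H k D ≤ ENNReal.ofReal (pathCost n H k v D) :=
  (minDiscreteTime_le h.mem_discreteTimes).trans (ENNReal.ofReal_le_ofReal (h.le_pathCost hn hH hk))

lemma ScheduleS.ratio_le (hn : 1 ≤ n) (hH : 0 < H) (hI : IsInstance k D)
    (h : ScheduleS n H k D T v) :
    ratio n H k D ≤ ENNReal.ofReal (pathCost n H k v D / pathNorm n H k v D) := by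
  rw [ENNReal.ofReal_div_of_pos (h.pathNorm_pos hH hI)]
  exact ENNReal.div_le_div (h.minDiscreteTime_le_pathCost hn hH hI.1)
    (pathNorm_le_minContinuousTime hn hH hI.1 v)

lemma ScheduleS.minContinuousTime_mainPathNetwork_le (hn : 1 ≤ n) (hH : 0 < H)
    (hI : IsInstance k D) (h : ScheduleS n H k D T v) :
    minContinuousTime n H (mainPathNetwork k v) D ≤ minContinuousTime n H k D := by
  refine le_trans ?_ (pathNorm_le_minContinuousTime hn hH hI.1 v)
  have hpos := h.pathNorm_pos hH hI
  rw [← pathNorm_mainPathNetwork] at hpos ⊢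
  exact minContinuousTime_le (pathNorm_mem_continuousTimes hn hH (mainPathNetwork_nonneg hI.1)
    mainPathNetwork_of_not_le hI.2.1 hpos)

/-- If all resistances lie on the route to `v`, the path cost for `v` bounds the time, whichever
valve is the last to be closed; so in the class `C` the schedule attains the discrete minimum. -/
lemma ScheduleS.le_pathCost_of_off (hn : 1 ≤ n) (hH : 0 < H) (hI : IsInstance k D)
    (hoff : ∀ e, ¬ e ≤ v.1 → k e = 0) {w : Sink N} (h : ScheduleS n H k D T w) :
    T ≤ pathCost n H k v D :=
  (h.le_pathCost hn hH hI.1).trans (pathCost_mono hn hH hI.1 hI.1 hI.2.1 fun e _ hke =>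
    ⟨by
      by_contra hc
      exact hke.ne' (hoff e hc), le_rfl⟩)

lemma continuous_pathNorm_add_const (hn : 1 ≤ n) :
    Continuous fun ε => pathNorm n H (fun e => k e + ε) v D := by
  unfold pathNorm
  refine Continuous.rpow_const ?_ fun _ => Or.inr (inv_nonneg.2 (by linarith))
  fun_prop

open Filter Topology in
/-- The quotient of the path cost and the path norm is a limit of times of the schedule in the class
`C`: the resistances on the route to `v` are increased by `ε` to make them positive, the other ones
are dropped, and the demand is scaled to be met in one unit of time. -/
lemma pathCost_div_pathNorm_le_iSup (hn : 1 ≤ n) (hH : 0 < H) (hk : ∀ e, 0 ≤ k e)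
    (hD : ∀ i, 0 ≤ D i) {e : Edge N} {i : Sink N} (hev : e ≤ v.1) (hei : e ≤ i.1) (hke : 0 < k e)
    (hi : 0 < D i) :
    ENNReal.ofReal (pathCost n H k v D / pathNorm n H k v D) ≤
      ⨆ (k : Edge N → ℝ) (D : Sink N → ℝ) (T : ℝ) (v : Sink N) (_ : IsInstance k D)
        (_ : InClassC k) (_ : IsUnitDemand n H k D) (_ : ScheduleS n H k D T v),
        ENNReal.ofReal T := by
  have h0 : 0 < pathNorm n H k v D := pathNorm_pos hH hk hD hev hei hke hi
  have hlim : Tendsto (fun ε => ENNReal.ofReal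
      (pathCost n H k v D / pathNorm n H (fun e => k e + ε) v D)) (𝓝[>] 0)
      (𝓝 (ENNReal.ofReal (pathCost n H k v D / pathNorm n H k v D))) := by
    refine ENNReal.tendsto_ofReal (tendsto_const_nhds.div ?_ h0.ne')
    simpa using ((continuous_pathNorm_add_const (H := H) (k := k) (v := v) (D := D) hn).tendsto
      0).mono_left nhdsWithin_le_nhds
  refine le_of_tendsto hlim ?_
  filter_upwards [self_mem_nhdsWithin] with ε hε
  have hε : 0 < ε := hε
  have hk0 : ∀ e, 0 < k e + ε := fun e => by linarith [hk e]
  set k' := mainPathNetwork (fun e => k e + ε) v with hk'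
  have hk'0 : ∀ e, 0 ≤ k' e := mainPathNetwork_nonneg fun e => (hk0 e).le
  have hoff : ∀ e, ¬ e ≤ v.1 → k' e = 0 := mainPathNetwork_of_not_le
  rw [← pathNorm_mainPathNetwork, ← hk']
  have hke' : 0 < k' e := by
    rw [hk', mainPathNetwork_of_le hev]
    exact hk0 e
  have hc : 0 < pathNorm n H k' v D := pathNorm_pos hH hk'0 hD hev hei hke' hi
  set c := pathNorm n H k' v D with hc'
  have hD' : ∀ j, 0 ≤ (c⁻¹ • D) j := fun j => mul_nonneg (inv_nonneg.2 hc.le) (hD j)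
  have hDi : 0 < (c⁻¹ • D) i := mul_pos (inv_pos.2 hc) hi
  obtain ⟨T, w, hS⟩ := exists_scheduleS hn hH hk'0 hD' ⟨i, hDi⟩
  have hT : pathCost n H k v D / c ≤ T := by
    refine le_trans ?_ (pathCost_le_of_mem_discreteTimes hn hH hk'0 hoff hS.mem_discreteTimes)
    rw [pathCost_smul, div_eq_inv_mul]
    refine mul_le_mul_of_nonneg_left (pathCost_mono hn hH hk'0 hk hD fun f hf _ => ⟨hf, ?_⟩)
      (inv_nonneg.2 hc.le)
    rw [hk', mainPathNetwork_of_le hf]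
    linarith
  refine (ENNReal.ofReal_le_ofReal hT).trans ?_
  refine le_iSup_of_le k' <| le_iSup_of_le (c⁻¹ • D) <| le_iSup_of_le T <| le_iSup_of_le w <|
    le_iSup_of_le ⟨hk'0, hD', i, hDi, e, hei, hke'⟩ <|
    le_iSup_of_le (inClassC_mainPathNetwork fun e _ => hk0 e) <|
    le_iSup_of_le (isUnitDemand_of_pathNorm_le_one hn hH hk'0 hoff hD'
      (pathNorm_inv_smul_self hn hH hk'0 hD hc).le) <| le_iSup_of_le hS le_rfl

lemma ScheduleS.pathCost_div_pathNorm_le_iSup (hn : 1 ≤ n) (hH : 0 < H) (hI : IsInstance k D)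
    (h : ScheduleS n H k D T v) :
    ENNReal.ofReal (pathCost n H k v D / pathNorm n H k v D) ≤
      ⨆ (k : Edge N → ℝ) (D : Sink N → ℝ) (T : ℝ) (v : Sink N) (_ : IsInstance k D)
        (_ : InClassC k) (_ : IsUnitDemand n H k D) (_ : ScheduleS n H k D T v),
        ENNReal.ofReal T := by
  obtain ⟨e, he, hke⟩ := h.exists_resistance_pos hH hI.1 hI.2.2
  exact SupplyNetwork.pathCost_div_pathNorm_le_iSup hn hH hI.1 hI.2.1 he he hke h.demand_pos

end

end SupplyNetwork

theorem mainTheorem3 (N : RootedTree) [Fintype N] (n H : ℝ) (hn : 1 ≤ n) (hH : 0 < H) :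
    -- the supremum of `R` is given by the class `C`
    (⨆ (k : Edge N → ℝ) (D : Sink N → ℝ) (_ : IsInstance k D), ratio n H k D) =
      (⨆ (k : Edge N → ℝ) (D : Sink N → ℝ) (_ : IsInstance k D) (_ : InClassC k),
        ratio n H k D) ∧
    -- it is the supremum, over the class `C`, of the time of schedule `S` for unit-time demands
    (⨆ (k : Edge N → ℝ) (D : Sink N → ℝ) (_ : IsInstance k D), ratio n H k D) =
      (⨆ (k : Edge N → ℝ) (D : Sink N → ℝ) (T : ℝ) (v : Sink N) (_ : IsInstance k D)
        (_ : InClassC k) (_ : IsUnitDemand n H k D) (_ : ScheduleS n H k D T v),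
        ENNReal.ofReal T) ∧
    -- schedule `S` takes the longest time in the class `C`
    (⨆ (k : Edge N → ℝ) (D : Sink N → ℝ) (T : ℝ) (v : Sink N) (_ : IsInstance k D)
        (_ : IsUnitDemand n H k D) (_ : ScheduleS n H k D T v), ENNReal.ofReal T) =
      (⨆ (k : Edge N → ℝ) (D : Sink N → ℝ) (T : ℝ) (v : Sink N) (_ : IsInstance k D)
        (_ : InClassC k) (_ : IsUnitDemand n H k D) (_ : ScheduleS n H k D T v),
        ENNReal.ofReal T) ∧
    -- schedule `S` can be executed, and in the class `C` it is optimal for discrete valves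
    (∀ (k : Edge N → ℝ) (D : Sink N → ℝ), IsInstance k D →
      (∃ T v, ScheduleS n H k D T v) ∧
      (InClassC k → ∀ T v, ScheduleS n H k D T v → IsLeast (discreteTimes n H k D) T)) ∧
    -- instance by instance, passing to the path of the valve that closes last increases the time
    -- of schedule `S`, does not increase the time with continuous valves, and increases `R`
    (∀ (k : Edge N → ℝ) (D : Sink N → ℝ), IsInstance k D →
      ∀ T v, ScheduleS n H k D T v →
        IsInstance (mainPathNetwork k v) D ∧
        ((∀ e : Edge N, e ≤ v.1 → 0 < k e) → InClassC (mainPathNetwork k v)) ∧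
        (∀ T' v', ScheduleS n H (mainPathNetwork k v) D T' v' → T ≤ T') ∧
        minContinuousTime n H (mainPathNetwork k v) D ≤ minContinuousTime n H k D ∧
        ratio n H k D ≤ ratio n H (mainPathNetwork k v) D) := by
  have hexec : ∀ (k : Edge N → ℝ) (D : Sink N → ℝ), IsInstance k D →
      ∃ T v, ScheduleS n H k D T v := fun k D hI =>
    exists_scheduleS hn hH hI.1 hI.2.1 (hI.2.2.imp fun i hi => hi.1)
  -- the suprema are compared in a cycle: all ratios are bounded by times in the class `C`,
  -- which are bounded by ratios in the class `C`
  have hratio_le : (⨆ (k : Edge N → ℝ) (D : Sink N → ℝ) (_ : IsInstance k D), ratio n H k D) ≤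
      (⨆ (k : Edge N → ℝ) (D : Sink N → ℝ) (T : ℝ) (v : Sink N) (_ : IsInstance k D)
        (_ : InClassC k) (_ : IsUnitDemand n H k D) (_ : ScheduleS n H k D T v),
        ENNReal.ofReal T) := by
    refine iSup_le fun k => iSup_le fun D => iSup_le fun hI => ?_
    obtain ⟨T, v, hS⟩ := hexec k D hI
    exact (hS.ratio_le hn hH hI).trans (hS.pathCost_div_pathNorm_le_iSup hn hH hI)
  have hC_le : (⨆ (k : Edge N → ℝ) (D : Sink N → ℝ) (T : ℝ) (v : Sink N) (_ : IsInstance k D)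
        (_ : InClassC k) (_ : IsUnitDemand n H k D) (_ : ScheduleS n H k D T v),
        ENNReal.ofReal T) ≤
      (⨆ (k : Edge N → ℝ) (D : Sink N → ℝ) (_ : IsInstance k D) (_ : InClassC k),
        ratio n H k D) := by
    refine iSup_le fun k => iSup_le fun D => iSup_le fun T => iSup_le fun v => iSup_le fun hI =>
      iSup_le fun hC => iSup_le fun hU => iSup_le fun hS => ?_
    refine le_iSup_of_le k <| le_iSup_of_le D <| le_iSup_of_le hI <| le_iSup_of_le hC ?_
    -- a unit demand has continuous time at most one, so the ratio is at least the discrete time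
    obtain ⟨w, -, hoff⟩ := hC
    have hT := (ENNReal.ofReal_le_ofReal (hS.le_pathCost_of_off hn hH hI hoff)).trans
      (pathCost_le_minDiscreteTime hn hH hI.1 hoff)
    have h1 : minContinuousTime n H k D ≤ 1 := by
      simpa using minContinuousTime_le hU.mem_continuousTimes
    calc ENNReal.ofReal T = ENNReal.ofReal T / 1 := (div_one _).symm
      _ ≤ ratio n H k D := ENNReal.div_le_div hT h1
  have hclass_le : (⨆ (k : Edge N → ℝ) (D : Sink N → ℝ) (_ : IsInstance k D) (_ : InClassC k),
      ratio n H k D) ≤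
      (⨆ (k : Edge N → ℝ) (D : Sink N → ℝ) (_ : IsInstance k D), ratio n H k D) :=
    iSup₂_mono fun k D => iSup_mono fun _ => iSup_le fun _ => le_rfl
  refine ⟨le_antisymm (hratio_le.trans hC_le) hclass_le,
    le_antisymm hratio_le (hC_le.trans hclass_le), le_antisymm ?_ ?_, ?_, ?_⟩
  · refine iSup_le fun k => iSup_le fun D => iSup_le fun T => iSup_le fun v => iSup_le fun hI =>
      iSup_le fun hU => iSup_le fun hS => ?_
    refine le_trans (ENNReal.ofReal_le_ofReal ?_) (hS.pathCost_div_pathNorm_le_iSup hn hH hI)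
    exact (hS.le_pathCost hn hH hI.1).trans (le_div_self (pathCost_nonneg hH hI.1 hI.2.1)
      (hS.pathNorm_pos hH hI) (hU.pathNorm_le_one hn hH hI.1 v))
  · exact iSup₂_mono fun k D => iSup₂_mono fun T v => iSup_mono fun _ => iSup_le fun _ => le_rfl
  · refine fun k D hI => ⟨hexec k D hI, fun hC T v hS => ⟨hS.mem_discreteTimes, fun T' hT' => ?_⟩⟩
    obtain ⟨w, -, hoff⟩ := hC
    exact (hS.le_pathCost_of_off hn hH hI hoff).trans
      (pathCost_le_of_mem_discreteTimes hn hH hI.1 hoff hT')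
  · intro k D hI T v hS
    have hk' := mainPathNetwork_nonneg (v := v) hI.1
    have hcont := hS.minContinuousTime_mainPathNetwork_le hn hH hI
    refine ⟨hS.isInstance_mainPathNetwork hH hI, inClassC_mainPathNetwork, fun T' v' hS' => ?_,
      hcont, ENNReal.div_le_div ?_ hcont⟩
    · refine (hS.le_pathCost hn hH hI.1).trans ?_
      rw [← pathCost_mainPathNetwork]
      exact pathCost_le_of_mem_discreteTimes hn hH hk' mainPathNetwork_of_not_le
        hS'.mem_discreteTimes
    · refine (hS.minDiscreteTime_le_pathCost hn hH hI.1).trans ?_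
      rw [← pathCost_mainPathNetwork]
      exact pathCost_le_minDiscreteTime hn hH hk' mainPathNetwork_of_not_le
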